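/- **Conventions.** A Banach analytic manifold is a connected topological space in which each point has a neighborhood homeomorphic to an open set in a complex Banach space, the transition maps being holomorphic. For Banach analytic manifolds $A$, $X$, let $\mathrm{Hol}(A,X)$ be the set of holomorphic maps $A\to X$ with the compact-open topology. For a sequence $\{f_k\}\subset \mathrm{Hol}(A,X)$ let $Z_{\{f_k\}}$ be the set of $a\in A$ such that $\{f_k(a)\}$ converges in $X$. For $S\subset A$ let $S^u$ be the set of $z\in \overline S$ such that, for every connected open neighborhood $U$ of $z$, every holomorphic function $g:U\to\mathbb C$ vanishing on $U\cap S$ vanishes identically on $U$. The manifold $X$ has the *strong Vitali property* (SVP) if for every Banach analytic manifold $A$, every sequence $\{f_k\}\subset \mathrm{Hol}(A,X)$ with $Z^u_{\{f_k\}}\neq\emptyset$ converges in $\mathrm{Hol}(A,X)$; it has the *weak Vitali property* (WVP) if for every Banach analytic manifold $A$, every sequence $\{f_k\}\subset \mathrm{Hol}(A,X)$ with $Z_{\{f_k\}}\cap Z^u_{\{f_k\}}\neq\emptyset$ converges in $\mathrm{Hol}(A,X)$. A domain (non-empty connected open set) $\Omega$ in a complex Banach space $E$ is *balanced* if $\lambda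 x\in\Omega$ for all $x\in\Omega$ and all $\lambda\in\mathbb C$ with $|\lambda|<1$; its Minkowski gauge is $h_\Omega(x)=\inf\{\lambda>0: x\in\lambda\Omega\}$, $x\in E$. A real-valued function on $\Omega$ is *plurisubharmonic* if it is upper semicontinuous and its restriction to the intersection of $\Omega$ with each complex line is subharmonic. **Proposition 4.6.** Let $\Omega$ be a balanced domain in a complex Banach space $E$. Then the following statements are equivalent: 1. $\Omega$ has WVP. 2. $\Omega$ is bounded, and $h_\Omega$ is continuous on $E$ and plurisubharmonic on $\Omega$. 3. $\Omega$ has SVP. -/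

import Mathlib

open Set Filter Topology
open scoped Manifold ContDiff

universe u v

namespace Vitali

/-- A Banach analytic manifold modelled on the complex Banach space `F` is a connected topological
space with an atlas of charts onto open subsets of `F` whose transition maps are holomorphic.
Since it is connected, all of its charts may be taken in one and the same Banach space. -/
class BanachAnalyticManifold (F : Type v) [NormedAddCommGroup F] [NormedSpace ℂ F]
    (A : Type v) [TopologicalSpace A] [ChartedSpace F A] : Prop where
  complete : CompleteSpace F
  connected : ConnectedSpace A
  isManifold : IsManifold 𝓘(ℂ, F) ω A

section Hol

variable (F : Type v) [NormedAddCommGroup F] [NormedSpace ℂ F]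
  (A : Type v) [TopologicalSpace A] [ChartedSpace F A]
  (E : Type*) [NormedAddCommGroup E] [NormedSpace ℂ E]
  (X : Type*) [TopologicalSpace X] [ChartedSpace E X]

/-- `Hol(A, X)`: the holomorphic maps from `A` (modelled on `F`) to `X` (modelled on `E`).
As a subtype of `C(A, X)` it carries the compact-open topology. -/
abbrev Hol : Type _ :=
  {f : C(A, X) // MDifferentiable 𝓘(ℂ, F) 𝓘(ℂ, E) f}

variable {F A E X}

/-- `Z_{f_k}`: the set of points of `A` at which the sequence `f_k` converges in `X`. -/
def convergenceSet (f : ℕ → Hol F A E X) : Set A :=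
  {a | ∃ x : X, Tendsto (fun k => (f k).1 a) atTop (𝓝 x)}

variable (F)

/-- `S^u`: the points `z` of the closure of `S` such that, for every connected (open) neighbourhood
`U` of `z`, each holomorphic function on `U` which vanishes on `U ∩ S` vanishes on `U`. -/
def uniquenessPoints (S : Set A) : Set A :=
  {z | z ∈ closure S ∧ ∀ U : Set A, IsOpen U → IsConnected U → z ∈ U →
    ∀ g : A → ℂ, MDifferentiableOn 𝓘(ℂ, F) 𝓘(ℂ, ℂ) g U →
      (∀ a ∈ U ∩ S, g a = 0) → ∀ a ∈ U, g a = 0}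

end Hol

section Properties

variable (E : Type u) [NormedAddCommGroup E] [NormedSpace ℂ E]
  (X : Type u) [TopologicalSpace X] [ChartedSpace E X]

/-- The strong Vitali property of `X`: for every Banach analytic manifold `A`, every sequence in
`Hol(A, X)` with `Z^u ≠ ∅` converges in `Hol(A, X)`. The second universe parameter, `v`, is that
of the source manifold and of its model space. -/
def HasSVP : Prop :=
  ∀ (F : Type v) [NormedAddCommGroup F] [NormedSpace ℂ F]
    (A : Type v) [TopologicalSpace A] [ChartedSpace F A] [BanachAnalyticManifold F A]
    (f : ℕ → Hol F A E X),
    (uniquenessPoints F (convergenceSet f)).Nonempty →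
      ∃ g : Hol F A E X, Tendsto f atTop (𝓝 g)

/-- The weak Vitali property of `X`: for every Banach analytic manifold `A`, every sequence in
`Hol(A, X)` with `Z ∩ Z^u ≠ ∅` converges in `Hol(A, X)`. -/
def HasWVP : Prop :=
  ∀ (F : Type v) [NormedAddCommGroup F] [NormedSpace ℂ F]
    (A : Type v) [TopologicalSpace A] [ChartedSpace F A] [BanachAnalyticManifold F A]
    (f : ℕ → Hol F A E X),
    (convergenceSet f ∩ uniquenessPoints F (convergenceSet f)).Nonempty →
      ∃ g : Hol F A E X, Tendsto f atTop (𝓝 g)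

end Properties

/-- Subharmonicity of a real-valued function on an open subset `U` of `ℂ`: upper semicontinuity
and the sub-mean value inequality on every closed disc in `U`. (As `φ c` is finite and `φ` is
bounded above on circles, the inequality contains the integrability of `φ` on the circle.) -/
def SubharmonicOn (φ : ℂ → ℝ) (U : Set ℂ) : Prop :=
  UpperSemicontinuousOn φ U ∧
    ∀ (c : ℂ) (r : ℝ), 0 < r → Metric.closedBall c r ⊆ U →
      CircleIntegrable φ c r ∧ φ c ≤ Real.circleAverage φ c r

/-- Plurisubharmonicity of a real-valued function on an open subset `Ω` of a complex normed space:
upper semicontinuity, and subharmonicity on the intersection of `Ω` with each complex line. -/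
def PlurisubharmonicOn {E : Type*} [NormedAddCommGroup E] [NormedSpace ℂ E]
    (φ : E → ℝ) (Ω : Set E) : Prop :=
  UpperSemicontinuousOn φ Ω ∧
    ∀ a b : E, SubharmonicOn (fun z : ℂ => φ (a + z • b)) {z : ℂ | a + z • b ∈ Ω}

/-- A balanced domain: a connected non-empty open set containing `z • x` whenever it contains `x`
and `z` is in the open unit disc. -/
structure IsBalancedDomain {E : Type*} [NormedAddCommGroup E] [NormedSpace ℂ E]
    (Ω : TopologicalSpace.Opens E) : Prop where
  isConnected : IsConnected (Ω : Set E)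
  smul_mem : ∀ x ∈ Ω, ∀ z : ℂ, ‖z‖ < 1 → z • x ∈ Ω

end Vitali

/-! Necessity is tested on sequences of maps from the unit disc. An unbounded Ω admits `ψ k z • x
k`, where the scalar factors acquire zeros accumulating at 0 while the norms blow up at `I / 2`. A
jump of the gauge admits dilated discs `z • y k` whose limit disc leaves Ω. If the sub-mean value
inequality fails, approximating the logarithm of the gauge on the circle by `Re P` and dividing by
the exponential of `P` gives a disc `G` with gauge below 1 on the circle and above 1 at the centre;
rescaled copies converge inside Ω near some points, but reach the boundary at an interior maximum.

For sufficiency, a bounded sequence is one holomorphic map Φ into the Banach space of bounded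
sequences. Modulo the closed subspace of convergent sequences, Φ vanishes on the convergence set;
functionals on the quotient and one uniqueness point make it vanish everywhere
(`exists_tendstoLocallyUniformly`). The limit has gauge at most 1, and less than 1 somewhere; the
strong maximum principle `SubMean.comp_lt_one` keeps it in Ω. That principle rests on a maximum
principle along holomorphic curves, although the hypothesis only concerns complex lines: Taylor
approximation reduces to polynomial curves, and doubling of variables to lines
(`SubMean.false_of_barrier_inner`). -/

namespace Vitali

/-! ### Gauges of balanced domains -/

section Gauge

variable {E : Type*} [NormedAddCommGroup E] [NormedSpace ℂ E] {Ω : TopologicalSpace.Opens E}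

theorem IsBalancedDomain.zero_mem (hΩ : IsBalancedDomain Ω) : (0 : E) ∈ Ω := by
  obtain ⟨x, hx⟩ := hΩ.isConnected.nonempty
  simpa using hΩ.smul_mem x hx 0 (by simp)

theorem IsBalancedDomain.balanced (hΩ : IsBalancedDomain Ω) : Balanced ℂ (Ω : Set E) := by
  rw [balanced_iff_smul_mem]
  intro z hz x hx
  -- Openness provides `t > 1` with `t • x` still in Ω; this absorbs scalars of modulus exactly 1.
  have hc : Tendsto (fun t : ℝ => (t : ℂ) • x) (𝓝[>] 1) (𝓝 x) := by
    have : Continuous fun t : ℝ => (t : ℂ) • x := by fun_prop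
    simpa using (this.tendsto 1).mono_left nhdsWithin_le_nhds
  obtain ⟨t, ht, ht1⟩ := ((hc.eventually (Ω.isOpen.mem_nhds hx)).and self_mem_nhdsWithin).exists
  have ht1 : 1 < t := ht1
  have h0 : (t : ℂ) ≠ 0 := by exact_mod_cast (by positivity : t ≠ 0)
  have := hΩ.smul_mem _ ht (z * (t : ℂ)⁻¹) (by
    rw [norm_mul, norm_inv, Complex.norm_real, Real.norm_of_nonneg (by positivity)]
    exact (mul_le_mul_of_nonneg_right hz (by positivity)).trans_lt (by
      rw [one_mul]; exact inv_lt_one_of_one_lt₀ ht1))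
  rwa [smul_smul, mul_assoc, inv_mul_cancel₀ h0, mul_one] at this

theorem IsBalancedDomain.gauge_smul (hΩ : IsBalancedDomain Ω) (z : ℂ) (x : E) :
    gauge (Ω : Set E) (z • x) = ‖z‖ * gauge (Ω : Set E) x :=
  _root_.gauge_smul hΩ.balanced z x

theorem IsBalancedDomain.absorbent (hΩ : IsBalancedDomain Ω) : Absorbent ℝ (Ω : Set E) :=
  absorbent_nhds_zero (Ω.isOpen.mem_nhds hΩ.zero_mem)

theorem IsBalancedDomain.mem_iff (hΩ : IsBalancedDomain Ω) {x : E} :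
    x ∈ Ω ↔ gauge (Ω : Set E) x < 1 := by
  refine ⟨fun h => gauge_lt_one_of_mem_of_isOpen Ω.isOpen h, fun h => ?_⟩
  obtain ⟨b, hb0, hb1, y, hy, rfl⟩ := exists_lt_of_gauge_lt hΩ.absorbent h
  have := hΩ.smul_mem y hy (b : ℂ) (by
    rwa [Complex.norm_real, Real.norm_of_nonneg hb0.le])
  simpa using this

/-- The gauge of a balanced domain is upper semicontinuous. -/
theorem IsBalancedDomain.isOpen_gauge_lt (hΩ : IsBalancedDomain Ω) (c : ℝ) :
    IsOpen {x : E | gauge (Ω : Set E) x < c} := by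
  rcases le_or_gt c 0 with hc | hc
  · convert isOpen_empty
    ext x
    simpa using hc.trans (gauge_nonneg x)
  · have : {x : E | gauge (Ω : Set E) x < c} = (fun x => ((c⁻¹ : ℝ) : ℂ) • x) ⁻¹' Ω := by
      ext x
      rw [mem_preimage, SetLike.mem_coe, hΩ.mem_iff, hΩ.gauge_smul, Complex.norm_real,
        Real.norm_of_nonneg (by positivity), inv_mul_lt_one₀ hc]
      rfl
    rw [this]
    exact Ω.isOpen.preimage (by fun_prop)

end Gauge

/-! ### Holomorphy in charts -/

section Manifold

variable {F A : Type*} [NormedAddCommGroup F] [NormedSpace ℂ F] [TopologicalSpace A]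
  [ChartedSpace F A] {E : Type*} [NormedAddCommGroup E] [NormedSpace ℂ E]
  {Ω : TopologicalSpace.Opens E}

theorem mdifferentiableAt_opens_iff {f : A → Ω} {a : A} :
    MDifferentiableAt 𝓘(ℂ, F) 𝓘(ℂ, E) f a ↔
      MDifferentiableAt 𝓘(ℂ, F) 𝓘(ℂ, E) (fun x => (f x : E)) a := by
  rw [mdifferentiableAt_iff, mdifferentiableAt_iff, Topology.IsInducing.subtypeVal.continuousAt_iff]
  rfl

theorem mdifferentiableAt_iff_comp_chart_symm {g : A → E} {a : A} :
    MDifferentiableAt 𝓘(ℂ, F) 𝓘(ℂ, E) g a ↔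
      ContinuousAt g a ∧ DifferentiableAt ℂ (g ∘ (chartAt F a).symm) (chartAt F a a) := by
  rw [mdifferentiableAt_iff]
  simp only [writtenInExtChartAt, mfld_simps, differentiableWithinAt_univ]
  rfl

/-- A holomorphic function is holomorphic in the coordinates of every chart. -/
theorem differentiableOn_comp_chart_symm [IsManifold 𝓘(ℂ, F) ω A] {g : A → E} {U : Set A}
    (hg : MDifferentiableOn 𝓘(ℂ, F) 𝓘(ℂ, E) g U) (a : A) :
    DifferentiableOn ℂ (g ∘ (chartAt F a).symm)
      ((chartAt F a).target ∩ (chartAt F a).symm ⁻¹' U) := by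
  have : IsManifold 𝓘(ℂ, F) 1 A := IsManifold.of_le (n := ω) (by simp)
  rw [← mdifferentiableOn_iff_differentiableOn]
  refine hg.comp ((mdifferentiableOn_atlas_symm (chart_mem_atlas F a)).mono inter_subset_left)
    inter_subset_right

end Manifold

/-! ### The unit disc as a test manifold -/

section UnitDisc

/-- The open unit disc, as an open subset of a copy of `ℂ` in the universe `v`. -/
def unitDisc : TopologicalSpace.Opens (ULift.{v} ℂ) :=
  ⟨ULift.down ⁻¹' Metric.ball 0 1, Metric.isOpen_ball.preimage continuous_uliftDown⟩

theorem unitDisc_isConnected : IsConnected (unitDisc.{v} : Set (ULift.{v} ℂ)) := by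
  have h : (unitDisc.{v} : Set (ULift.{v} ℂ)) = ULift.up '' Metric.ball (0 : ℂ) 1 := by
    ext ⟨z⟩
    simp [unitDisc]
  rw [h]
  exact ((convex_ball (0 : ℂ) 1).isConnected (by simp)).image _ continuous_uliftUp.continuousOn

instance : BanachAnalyticManifold (ULift.{v} ℂ) unitDisc.{v} where
  complete := inferInstance
  connected := isConnected_iff_connectedSpace.mp unitDisc_isConnected
  isManifold := inferInstance

variable {E : Type*} [NormedAddCommGroup E] [NormedSpace ℂ E] {Ω : TopologicalSpace.Opens E}

theorem mdifferentiable_unitDisc {G : ℂ → E} (hG : DifferentiableOn ℂ G (Metric.ball 0 1)) :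
    MDifferentiable 𝓘(ℂ, ULift.{v} ℂ) 𝓘(ℂ, E) (fun a : unitDisc.{v} => G a.1.down) := by
  intro a
  have h1 : MDifferentiableAt 𝓘(ℂ, ULift.{v} ℂ) 𝓘(ℂ, E)
      (G ∘ ContinuousLinearEquiv.ulift (R₁ := ℂ) (M₁ := ℂ)) a.1 := by
    rw [mdifferentiableAt_iff_differentiableAt]
    exact DifferentiableAt.comp _ (hG.differentiableAt (Metric.isOpen_ball.mem_nhds a.2))
      (ContinuousLinearEquiv.differentiableAt _)
  exact h1.comp a (contMDiff_subtype_val (n := 1) a |>.mdifferentiableAt (by simp))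

/-- The holomorphic map on the disc given by a function of one variable. -/
noncomputable def discMap (G : ℂ → E) (hG : DifferentiableOn ℂ G (Metric.ball 0 1))
    (hm : MapsTo G (Metric.ball 0 1) Ω) : Hol (ULift.{v} ℂ) unitDisc.{v} E Ω :=
  ⟨⟨fun a => ⟨G a.1.down, hm a.2⟩, ((mdifferentiable_unitDisc hG).continuous).subtype_mk _⟩,
    fun a => mdifferentiableAt_opens_iff.mpr (mdifferentiable_unitDisc hG a)⟩

/-- The identity theorem in one variable, read through a chart that covers the whole disc: zeros
accumulating at `a` force vanishing on every connected neighbourhood. -/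
theorem mem_uniquenessPoints_unitDisc {S : Set unitDisc.{v}} {a : unitDisc.{v}}
    (h : ∃ᶠ z in 𝓝[≠] a.1.down, ∃ hz : ULift.up z ∈ unitDisc.{v}, ⟨ULift.up z, hz⟩ ∈ S) :
    a ∈ uniquenessPoints (ULift.{v} ℂ) S := by
  set e := chartAt (ULift.{v} ℂ) a
  have hsrc : ∀ b : unitDisc.{v}, b ∈ e.source := fun b => by
    simp [e, TopologicalSpace.Opens.chartAt_eq, OpenPartialHomeomorph.subtypeRestr_source]
    exact mem_univ _
  have he : ∀ b : unitDisc.{v}, e b = b.1 := fun b => rfl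
  have hinv : ∀ b : unitDisc.{v}, e.symm (ULift.up b.1.down) = b := fun b => e.left_inv (hsrc b)
  have hcont : Tendsto (fun z : ℂ => e.symm (ULift.up z)) (𝓝 a.1.down) (𝓝 a) := by
    have h1 := (e.continuousAt_symm (e.map_source (hsrc a))).tendsto
    rw [e.left_inv (hsrc a)] at h1
    exact h1.comp (continuous_uliftUp.tendsto a.1.down)
  refine ⟨?_, fun U hU hUc haU g hg h0 b hb => ?_⟩
  · refine mem_closure_iff_frequently.mpr ?_
    refine hcont.frequently ((h.filter_mono nhdsWithin_le_nhds).mono ?_)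
    rintro z ⟨hz, hzS⟩
    rwa [hinv ⟨ULift.up z, hz⟩]
  set φ : unitDisc.{v} → ℂ := fun b => b.1.down
  have hφc : Continuous φ := continuous_uliftDown.comp continuous_subtype_val
  have hVeq : φ '' U = ULift.up ⁻¹' (e.target ∩ e.symm ⁻¹' U) := by
    ext z
    constructor
    · rintro ⟨b, hb, rfl⟩
      exact ⟨e.map_source (hsrc b), by simpa [φ, hinv] using hb⟩
    · rintro ⟨hz, hzU⟩
      exact ⟨e.symm (ULift.up z), hzU, congrArg ULift.down (e.right_inv hz)⟩
  have hVo : IsOpen (φ '' U) := by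
    rw [hVeq]
    exact (e.isOpen_inter_preimage_symm hU).preimage continuous_uliftUp
  have hd : DifferentiableOn ℂ (fun z : ℂ => g (e.symm (ULift.up z))) (φ '' U) := by
    rw [hVeq]
    exact (differentiableOn_comp_chart_symm hg a).comp
      (ContinuousLinearEquiv.ulift (R₁ := ℂ) (M₁ := ℂ)).symm.differentiable.differentiableOn
      (fun z hz => hz)
  have hz := (hd.analyticOnNhd hVo).eqOn_zero_of_preconnected_of_frequently_eq_zero
    (hUc.image φ hφc.continuousOn).isPreconnected (mem_image_of_mem φ haU)
    ((h.and_eventually (nhdsWithin_le_nhds (hVo.mem_nhds (mem_image_of_mem φ haU)))).mono ?_)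
  · simpa [φ, hinv] using hz (mem_image_of_mem φ hb)
  · rintro z ⟨⟨hz, hzS⟩, c, hc, rfl⟩
    simp only [φ, hinv]
    exact h0 c ⟨hc, hzS⟩

/-- The weak Vitali property for sequences of maps on the unit disc. -/
theorem HasWVP.tendsto_of_frequently {E : Type u} [NormedAddCommGroup E] [NormedSpace ℂ E]
    {Ω : TopologicalSpace.Opens E} (h : HasWVP.{u, v} E Ω) {f : ℕ → ℂ → E}
    (hf : ∀ k, DifferentiableOn ℂ (f k) (Metric.ball 0 1))
    (hm : ∀ k, MapsTo (f k) (Metric.ball 0 1) Ω) {z₀ : ℂ} (hz₀ : z₀ ∈ Metric.ball (0 : ℂ) 1)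
    (hc : ∃ x ∈ Ω, Tendsto (fun k => f k z₀) atTop (𝓝 x))
    (hfr : ∃ᶠ z in 𝓝[≠] z₀, ∃ x ∈ Ω, Tendsto (fun k => f k z) atTop (𝓝 x)) {z : ℂ}
    (hz : z ∈ Metric.ball (0 : ℂ) 1) : ∃ x ∈ Ω, Tendsto (fun k => f k z) atTop (𝓝 x) := by
  have key : ∀ a : unitDisc.{v}, a ∈ convergenceSet
      (fun k => discMap.{v} (f k) (hf k) (hm k)) ↔
      ∃ x ∈ Ω, Tendsto (fun k => f k a.1.down) atTop (𝓝 x) := by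
    intro a
    constructor
    · rintro ⟨x, hx⟩
      exact ⟨x, x.2, (continuous_subtype_val.tendsto x).comp hx⟩
    · rintro ⟨x, hx, ht⟩
      exact ⟨⟨x, hx⟩, tendsto_subtype_rng.mpr ht⟩
  have hev : ∀ᶠ w in 𝓝[≠] z₀, w ∈ Metric.ball (0 : ℂ) 1 :=
    nhdsWithin_le_nhds (Metric.isOpen_ball.mem_nhds hz₀)
  obtain ⟨g, hg⟩ := h (ULift.{v} ℂ) unitDisc.{v} (fun k => discMap.{v} (f k) (hf k) (hm k))
    ⟨⟨ULift.up z₀, hz₀⟩, (key _).mpr hc, mem_uniquenessPoints_unitDisc <|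
      (hfr.and_eventually hev).mono fun w hw => ⟨hw.2, (key ⟨ULift.up w, hw.2⟩).mpr hw.1⟩⟩
  have h1 := (continuous_subtype_val.tendsto g).comp hg
  have h2 := ((continuous_eval_const (⟨ULift.up z, hz⟩ : unitDisc.{v})).tendsto g.1).comp h1
  exact (key ⟨ULift.up z, hz⟩).mp ⟨_, h2⟩

end UnitDisc

/-! ### Approximation by real parts of polynomials on the circle -/

section TrigonometricApproximation

/-- Trigonometric polynomials have the form `P + conj Q` on the circle. -/
theorem exists_polynomial_of_mem_span_fourier {T : ℝ} {f : C(AddCircle T, ℂ)}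
    (hf : f ∈ Submodule.span ℂ (range (fourier (T := T)))) :
    ∃ P Q : Polynomial ℂ, ∀ x, f x = P.eval (x.toCircle : ℂ) +
      (starRingEnd ℂ) (Q.eval (x.toCircle : ℂ)) := by
  induction hf using Submodule.span_induction with
  | mem f hf =>
    obtain ⟨n, rfl⟩ := hf
    obtain ⟨m, rfl | rfl⟩ := n.eq_nat_or_neg
    · refine ⟨Polynomial.X ^ m, 0, fun x => ?_⟩
      simp [fourier_apply, AddCircle.toCircle_nsmul]
    · refine ⟨0, Polynomial.X ^ m, fun x => ?_⟩
      rw [fourier_neg]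
      simp [fourier_apply, AddCircle.toCircle_nsmul]
  | zero => exact ⟨0, 0, by simp⟩
  | add f g _ _ hf hg =>
    obtain ⟨P, Q, h⟩ := hf
    obtain ⟨P', Q', h'⟩ := hg
    refine ⟨P + P', Q + Q', fun x => ?_⟩
    simp only [ContinuousMap.add_apply, h, h', Polynomial.eval_add, map_add]
    ring
  | smul c f _ hf =>
    obtain ⟨P, Q, h⟩ := hf
    refine ⟨Polynomial.C c * P, Polynomial.C ((starRingEnd ℂ) c) * Q, fun x => ?_⟩
    simp [h, mul_add]

/-- A continuous real function on the unit circle is uniformly approximated by the real parts of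
polynomials. -/
theorem exists_polynomial_re_near {u : ℂ → ℝ} (hu : Continuous u) {ε : ℝ} (hε : 0 < ε) :
    ∃ P : Polynomial ℂ, ∀ z ∈ Metric.sphere (0 : ℂ) 1, |(P.eval z).re - u z| < ε := by
  let f : C(AddCircle (1 : ℝ), ℂ) :=
    ⟨fun x => (u x.toCircle : ℂ), Complex.continuous_ofReal.comp (hu.comp
      (continuous_subtype_val.comp AddCircle.continuous_toCircle))⟩
  have hf : f ∈ closure (Submodule.span ℂ (range (fourier (T := (1 : ℝ)))) :
      Set C(AddCircle (1 : ℝ), ℂ)) := by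
    rw [← Submodule.topologicalClosure_coe, span_fourier_closure_eq_top]
    trivial
  obtain ⟨g, hg, hfg⟩ := Metric.mem_closure_iff.mp hf ε hε
  obtain ⟨P, Q, hPQ⟩ := exists_polynomial_of_mem_span_fourier hg
  refine ⟨P + Q, fun z hz => ?_⟩
  obtain ⟨x, hx⟩ := (AddCircle.homeomorphCircle (T := (1 : ℝ)) one_ne_zero).surjective
    ⟨z, by simpa [Submonoid.unitSphere] using hz⟩
  have hx : ((x.toCircle : Circle) : ℂ) = z := by
    rw [AddCircle.homeomorphCircle_apply] at hx
    rw [hx]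
  have h1 := (ContinuousMap.dist_apply_le_dist x).trans_lt hfg
  rw [dist_comm, dist_eq_norm] at h1
  have h2 := (Complex.abs_re_le_norm _).trans_lt h1
  simpa [hPQ, f, hx] using h2

end TrigonometricApproximation

/-- The mean value property of the real part of a holomorphic function. -/
theorem circleAverage_re {f : ℂ → ℂ} {U : Set ℂ} (hf : DifferentiableOn ℂ f U)
    {c : ℂ} {r : ℝ} (h : Metric.closedBall c |r| ⊆ U) :
    Real.circleAverage (fun z => (f z).re) c r = (f c).re := by
  have hd : DiffContOnCl ℂ f (Metric.ball c |r|) :=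
    (hf.mono ((closure_mono Metric.ball_subset_closedBall).trans
      (Metric.isClosed_closedBall.closure_eq.trans_subset h))).diffContOnCl
  rw [← hd.circleAverage]
  exact Complex.reCLM.circleAverage_comp_comm
    (hf.continuousOn.mono (Metric.sphere_subset_closedBall.trans h)).circleIntegrable'

/-! ### Consequences of the weak Vitali property -/

section Necessity

variable {E : Type u} [NormedAddCommGroup E] [NormedSpace ℂ E] {Ω : TopologicalSpace.Opens E}

/-- If Ω were unbounded, scalar functions of modulus below 1 with more and more zeros `a j → 0`,
multiplied by fast growing vectors of Ω, would converge at 0 and at each `a j` but diverge at `I /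
2`. -/
theorem HasWVP.isBounded (hΩ : IsBalancedDomain Ω) (h : HasWVP.{u, v} E Ω) :
    Bornology.IsBounded (Ω : Set E) := by
  by_contra hb
  have hb' : ∀ C : ℝ, ∃ x ∈ Ω, C < ‖x‖ := by
    simpa [isBounded_iff_forall_norm_le] using hb
  let a : ℕ → ℂ := fun j => ((1 / ((j : ℝ) + 1) : ℝ) : ℂ)
  have ha : ∀ j, ‖a j‖ ≤ 1 := fun j => by
    rw [Complex.norm_real, Real.norm_of_nonneg (by positivity), div_le_one (by positivity)]
    linarith [Nat.cast_nonneg (α := ℝ) j]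
  -- The factor `z` gives vanishing at 0 and the strict bound 1; halving bounds the other factors by
  -- 1. All zeros are real, so `I / 2` is not one of them.
  let ψ : ℕ → ℂ → ℂ := fun k z => z * ∏ j ∈ Finset.range k, ((z - a j) / 2)
  have hψd : ∀ k, Differentiable ℂ (ψ k) := fun k => by
    simp only [ψ]
    fun_prop
  have hψ1 : ∀ k, ∀ z ∈ Metric.ball (0 : ℂ) 1, ‖ψ k z‖ < 1 := by
    intro k z hz
    rw [mem_ball_zero_iff] at hz
    rw [norm_mul, norm_prod]
    refine (mul_le_of_le_one_right (norm_nonneg _) (Finset.prod_le_one (fun _ _ => norm_nonneg _)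
      fun j _ => ?_)).trans_lt hz
    rw [norm_div, Complex.norm_ofNat, div_le_one two_pos]
    linarith [norm_sub_le z (a j), ha j]
  have hw : (Complex.I / 2) ∈ Metric.ball (0 : ℂ) 1 := by
    rw [mem_ball_zero_iff, norm_div, Complex.norm_I, Complex.norm_ofNat]
    norm_num
  have hψw : ∀ k, 0 < ‖ψ k (Complex.I / 2)‖ := by
    intro k
    rw [norm_pos_iff]
    refine mul_ne_zero (by simp) (Finset.prod_ne_zero_iff.mpr fun j _ => ?_)
    refine div_ne_zero (fun h0 => ?_) two_ne_zero
    have := congrArg Complex.im h0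
    simp only [a, Complex.sub_im, Complex.ofReal_im] at this
    norm_num at this
  choose x hxΩ hx using fun k : ℕ => hb' (k / ‖ψ k (Complex.I / 2)‖)
  have hzero : ∀ j, ∀ k > j, ψ k (a j) = 0 := fun j k hk => by
    simp only [ψ]
    rw [Finset.prod_eq_zero (Finset.mem_range.mpr hk) (by simp), mul_zero]
  have hconv : ∀ j, Tendsto (fun k => ψ k (a j) • x k) atTop (𝓝 0) := fun j =>
    tendsto_const_nhds.congr' <| by
      filter_upwards [eventually_gt_atTop j] with k hk
      rw [hzero j k hk, zero_smul]
  have hat : Tendsto a atTop (𝓝[≠] 0) := by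
    refine tendsto_nhdsWithin_iff.mpr ⟨?_, Eventually.of_forall fun j => ?_⟩
    · have := (Complex.continuous_ofReal.tendsto 0).comp
        (tendsto_one_div_add_atTop_nhds_zero_nat (𝕜 := ℝ))
      rwa [Complex.ofReal_zero] at this
    · simp only [a, mem_compl_iff, mem_singleton_iff, Complex.ofReal_eq_zero]
      positivity
  obtain ⟨y, -, hy⟩ := h.tendsto_of_frequently (f := fun k z => ψ k z • x k)
    (fun k => ((hψd k).smul_const (x k)).differentiableOn)
    (fun k z hz => hΩ.smul_mem _ (hxΩ k) _ (hψ1 k z hz)) (z₀ := 0) (by simp)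
    ⟨0, hΩ.zero_mem, by simp [ψ]⟩
    (hat.frequently (Frequently.of_forall fun j => ⟨0, hΩ.zero_mem, hconv j⟩)) hw
  refine not_tendsto_atTop_of_tendsto_nhds hy.norm (tendsto_atTop_mono (fun k => ?_)
    tendsto_natCast_atTop_atTop)
  rw [norm_smul, mul_comm]
  exact ((div_lt_iff₀ (hψw k)).mp (hx k)).le

/-- Only lower semicontinuity is at stake. If it fails at `x`, vectors `y k → x` of smaller gauge
span discs in Ω whose limit is the disc spanned by `x`, which lies in Ω near 0 but not throughout.
-/
theorem HasWVP.continuous_gauge (hΩ : IsBalancedDomain Ω) (h : HasWVP.{u, v} E Ω) :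
    Continuous (gauge (Ω : Set E)) := by
  refine continuous_iff_continuousAt.mpr fun x => tendsto_order.mpr
    ⟨fun c hc => ?_, fun c hc => (hΩ.isOpen_gauge_lt c).mem_nhds hc⟩
  by_contra hcon
  have hfr : ∃ᶠ y in 𝓝 x, gauge (Ω : Set E) y ≤ c := by
    exact (not_eventually.mp hcon).mono fun y => not_lt.mp
  obtain ⟨y, hy, hyc⟩ := exists_seq_forall_of_frequently hfr
  obtain ⟨d, hcd, hdx⟩ := exists_between hc
  have hd : 0 < d := (gauge_nonneg (y 0)).trans_lt ((hyc 0).trans_lt hcd)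
  have hdn : ‖((d⁻¹ : ℝ) : ℂ)‖ = d⁻¹ := by
    rw [Complex.norm_real, Real.norm_of_nonneg (by positivity)]
  have hyΩ : ∀ k, ((d⁻¹ : ℝ) : ℂ) • y k ∈ Ω := fun k => by
    rw [hΩ.mem_iff, hΩ.gauge_smul, hdn, inv_mul_lt_one₀ hd]
    exact (hyc k).trans_lt hcd
  have hlim : ∀ z : ℂ, Tendsto (fun k => z • ((d⁻¹ : ℝ) : ℂ) • y k) atTop
      (𝓝 (z • ((d⁻¹ : ℝ) : ℂ) • x)) := fun z => (hy.const_smul _).const_smul _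
  have hx : 0 < gauge (Ω : Set E) x := hd.trans hdx
  have hnear : ∀ᶠ z : ℂ in 𝓝 0, z • ((d⁻¹ : ℝ) : ℂ) • x ∈ Ω := by
    have hc : Continuous fun z : ℂ => z • ((d⁻¹ : ℝ) : ℂ) • x := by fun_prop
    refine hc.continuousAt.eventually (Ω.isOpen.mem_nhds ?_)
    simpa using hΩ.zero_mem
  -- The limit at this interior point of the disc has gauge exactly 1.
  set w : ℂ := ((d / gauge (Ω : Set E) x : ℝ) : ℂ) with hw
  have hwn : ‖w‖ = d / gauge (Ω : Set E) x := by
    rw [Complex.norm_real, Real.norm_of_nonneg (by positivity)]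
  obtain ⟨p, hpΩ, hp⟩ := h.tendsto_of_frequently (f := fun k z => z • ((d⁻¹ : ℝ) : ℂ) • y k)
    (fun k => (differentiable_id.smul_const _).differentiableOn)
    (fun k z hz => hΩ.smul_mem _ (hyΩ k) _ (by simpa using hz)) (z₀ := 0) (by simp)
    ⟨_, hnear.self_of_nhds, hlim 0⟩
    ((hnear.filter_mono nhdsWithin_le_nhds).frequently.mono fun z hz => ⟨_, hz, hlim z⟩)
    (z := w) (by rw [mem_ball_zero_iff, hwn, div_lt_one hx]; exact hdx)
  rw [tendsto_nhds_unique hp (hlim w), hΩ.mem_iff, hΩ.gauge_smul, hΩ.gauge_smul, hdn, hwn] at hpΩ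
  refine hpΩ.ne ?_
  field_simp

/-- The sub-mean value inequality of the gauge on complex lines. -/
theorem HasWVP.gauge_le_circleAverage (hΩ : IsBalancedDomain Ω) (h : HasWVP.{u, v} E Ω)
    (hc : Continuous (gauge (Ω : Set E))) (a b : E) :
    gauge (Ω : Set E) a ≤ Real.circleAverage (fun z => gauge (Ω : Set E) (a + z • b)) 0 1 := by
  set g := gauge (Ω : Set E) with hg
  by_contra! hlt
  have hVc : Continuous fun z : ℂ => g (a + z • b) := hc.comp (by fun_prop)
  have hV0 : ∀ z : ℂ, 0 ≤ g (a + z • b) := fun z => gauge_nonneg _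
  have hVs : ∀ r : ℝ, Continuous fun z : ℂ => r • g (a + z • b) := fun r => hVc.const_smul r
  set m := Real.circleAverage (fun z => g (a + z • b)) 0 1 with hm
  have hm0 : 0 ≤ m := Real.circleAverage_nonneg_of_nonneg fun z _ => hV0 z
  obtain ⟨s, hms, hsa⟩ := exists_between hlt
  have hs : 0 < s := hm0.trans_lt hms
  -- The shift `s - m` makes the logarithm finite and raises the circle average from `m` to `s`.
  have hVε : ∀ z : ℂ, 0 < g (a + z • b) + (s - m) := fun z => by linarith [hV0 z]
  have huc : Continuous fun z : ℂ => Real.log (g (a + z • b) + (s - m)) :=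
    (hVc.add_const _).log fun z => (hVε z).ne'
  have hη : 0 < (Real.log (g a) - Real.log s) / 3 := by
    linarith [Real.log_lt_log hs hsa]
  set η := (Real.log (g a) - Real.log s) / 3 with hηd
  obtain ⟨P, hP⟩ := exists_polynomial_re_near huc hη
  have hP0 : (P.eval 0).re ≤ Real.log s + η := by
    rw [← circleAverage_re P.differentiable.differentiableOn (subset_univ _)]
    have hle : Real.circleAverage (fun z => (P.eval z).re) 0 1 ≤
        Real.circleAverage (fun z => s⁻¹ • g (a + z • b) + ((s - m) / s - 1 + Real.log s + η)) 0 1 := by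
      refine Real.circleAverage_mono
        (Complex.continuous_re.comp P.continuous).continuousOn.circleIntegrable'
        ((hVs _).add_const _).continuousOn.circleIntegrable' fun z hz => ?_
      rw [abs_one] at hz
      have h1 := (abs_lt.mp (hP z hz)).2
      -- The tangent to the logarithm at `s` takes the place of Jensen's inequality.
      have h2 := Real.log_le_sub_one_of_pos (div_pos (hVε z) hs)
      rw [Real.log_div (hVε z).ne' hs.ne', add_div] at h2
      rw [smul_eq_mul, inv_mul_eq_div]
      linarith
    refine hle.trans_eq ?_
    rw [Real.circleAverage_fun_add (hVs _).continuousOn.circleIntegrable'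
      continuousOn_const.circleIntegrable', Real.circleAverage_fun_smul, Real.circleAverage_const,
      ← hm, smul_eq_mul]
    field_simp
    ring
  -- One `η` pays for the approximation on the circle. At 0, `Re P + η` is at most `log s + 2 * η`,
  -- still below `log (g a)`, since `η` is a third of the gap.
  let G : ℂ → E := fun z => Complex.exp (-(P.eval z + η)) • (a + z • b)
  have hGd : Differentiable ℂ G := by
    have := P.differentiable (𝕜 := ℂ)
    simp only [G]
    fun_prop
  have hGg : ∀ z, g (G z) = Real.exp (-((P.eval z).re + η)) * g (a + z • b) := fun z => by
    simp only [G, hg, hΩ.gauge_smul, Complex.norm_exp, Complex.neg_re, Complex.add_re,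
      Complex.ofReal_re]
  have hsph : ∀ z ∈ Metric.sphere (0 : ℂ) 1, g (G z) < 1 := by
    intro z hz
    have h1 := (abs_lt.mp (hP z hz)).1
    have h2 : g (a + z • b) < Real.exp ((P.eval z).re + η) := by
      have := (Real.log_lt_iff_lt_exp (hVε z)).mp (show _ < (P.eval z).re + η by linarith)
      linarith
    rw [hGg, Real.exp_neg, inv_mul_lt_one₀ (Real.exp_pos _)]
    exact h2
  have hG0 : 1 < g (G 0) := by
    have hga : 0 < g a := hs.trans hsa
    rw [hGg, zero_smul, add_zero, Real.exp_neg, ← div_eq_inv_mul, one_lt_div (Real.exp_pos _),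
      ← Real.lt_log_iff_exp_lt hga]
    linarith
  have hgG : Continuous fun z => g (G z) := hc.comp hGd.continuous
  obtain ⟨w, hw, hmax⟩ := (isCompact_closedBall (0 : ℂ) 1).exists_isMaxOn ⟨0, by simp⟩
    hgG.continuousOn
  have hmax' : ∀ z ∈ Metric.closedBall (0 : ℂ) 1, g (G z) ≤ g (G w) := hmax
  have hM : 1 < g (G w) := hG0.trans_le (hmax' 0 (by simp))
  have hwb : w ∈ Metric.ball (0 : ℂ) 1 := by
    rcases (Metric.mem_closedBall.mp hw).lt_or_eq with h1 | h1
    · exact h1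
    · exact absurd (hsph w h1) hM.le.not_gt
  obtain ⟨z₁, hz₁, hz₁b⟩ : ∃ z₁, g (G z₁) < 1 ∧ z₁ ∈ Metric.ball (0 : ℂ) 1 := by
    have h1 : (1 : ℂ) ∈ closure (Metric.ball (0 : ℂ) 1) := by
      rw [closure_ball _ one_ne_zero]
      simp
    exact mem_closure_iff.mp h1 _ (isOpen_lt hgG continuous_const) (hsph 1 (by simp))
  set M := g (G w) with hMd
  have hM0 : 0 < M := one_pos.trans hM
  -- Strictly below `1 / M`, so each rescaled disc lies in Ω even at the maximum point `w`, where
  -- the limit has gauge 1.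
  let c : ℕ → ℝ := fun k => (1 - 1 / ((k : ℝ) + 1)) / M
  have hclim : Tendsto (fun k => ((c k : ℝ) : ℂ)) atTop (𝓝 ((M⁻¹ : ℝ) : ℂ)) := by
    refine (Complex.continuous_ofReal.tendsto _).comp ?_
    have := ((tendsto_one_div_add_atTop_nhds_zero_nat (𝕜 := ℝ)).const_sub 1).div_const M
    simpa [c] using this
  have hlim : ∀ z, Tendsto (fun k => ((c k : ℝ) : ℂ) • G z) atTop (𝓝 (((M⁻¹ : ℝ) : ℂ) • G z)) :=
    fun z => hclim.smul_const _
  have hmem : ∀ z, ((M⁻¹ : ℝ) : ℂ) • G z ∈ Ω ↔ g (G z) < M := fun z => by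
    rw [hΩ.mem_iff, hΩ.gauge_smul, Complex.norm_real, Real.norm_of_nonneg (by positivity),
      inv_mul_lt_one₀ hM0]
  have hnear : ∀ᶠ z in 𝓝 z₁, ((M⁻¹ : ℝ) : ℂ) • G z ∈ Ω := by
    filter_upwards [(isOpen_lt hgG continuous_const).mem_nhds (hz₁.trans hM)] with z hz
    exact (hmem z).mpr hz
  have hmaps : ∀ k, MapsTo (fun z => ((c k : ℝ) : ℂ) • G z) (Metric.ball 0 1) Ω := by
    intro k z hz
    have hk : 0 < 1 / ((k : ℝ) + 1) := by positivity
    have hk1 : 1 / ((k : ℝ) + 1) ≤ 1 := by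
      rw [div_le_one (by positivity)]
      linarith [Nat.cast_nonneg (α := ℝ) k]
    have hck : 0 ≤ c k := div_nonneg (by linarith) hM0.le
    rw [SetLike.mem_coe, hΩ.mem_iff, hΩ.gauge_smul, Complex.norm_real, Real.norm_of_nonneg hck]
    calc c k * g (G z) ≤ c k * M :=
          mul_le_mul_of_nonneg_left (hmax' z (Metric.ball_subset_closedBall hz)) hck
      _ = 1 - 1 / ((k : ℝ) + 1) := div_mul_cancel₀ _ hM0.ne'
      _ < 1 := by linarith
  obtain ⟨p, hpΩ, hp⟩ := h.tendsto_of_frequently (f := fun k z => ((c k : ℝ) : ℂ) • G z)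
    (fun k => (hGd.const_smul _).differentiableOn) hmaps hz₁b
    ⟨_, hnear.self_of_nhds, hlim z₁⟩
    ((hnear.filter_mono nhdsWithin_le_nhds).frequently.mono fun z hz => ⟨_, hz, hlim z⟩) hwb
  rw [tendsto_nhds_unique hp (hlim w), hmem] at hpΩ
  exact lt_irrefl _ hpΩ

end Necessity

/-- The sub-mean value inequality of a function on all circles in complex lines. -/
def SubMean {E : Type*} [NormedAddCommGroup E] [NormedSpace ℂ E] (φ : E → ℝ) : Prop :=
  ∀ a b : E, φ a ≤ Real.circleAverage (fun z : ℂ => φ (a + z • b)) 0 1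

/-! ### Maximum principles along holomorphic curves -/

section MaximumPrinciple

theorem SubMean.le_circleAverage {E : Type*} [NormedAddCommGroup E] [NormedSpace ℂ E] {φ : E → ℝ}
    (h : SubMean φ) (a b : E) (r : ℝ) :
    φ a ≤ Real.circleAverage (fun z : ℂ => φ (a + z • b)) 0 r := by
  rw [Real.circleAverage_eq_circleAverage_zero_one]
  simpa [mul_comm (r : ℂ), mul_smul] using h a ((r : ℂ) • b)

theorem SubMean.comp {E H : Type*} [NormedAddCommGroup E] [NormedSpace ℂ E]
    [NormedAddCommGroup H] [NormedSpace ℂ H] {φ : E → ℝ} (h : SubMean φ) (L : H →ₗ[ℂ] E) :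
    SubMean (φ ∘ L) := fun a b => by
  simpa using h (L a) (L b)

variable {H : Type*} [NormedAddCommGroup H] [InnerProductSpace ℂ H]

/-- The case of a Hilbert space, by doubling of variables: the penalisation `‖y‖ ^ 2` of the
distance to the curve has a pluriharmonic first order term. -/
theorem SubMean.false_of_barrier_inner [ProperSpace H] {φ : H → ℝ} (h : SubMean φ)
    (hφ : Continuous φ) {γ : ℂ → H} (hγ : Differentiable ℂ γ) {κ r : ℝ} (hκ : 0 < κ) (hr : 0 < r)
    (c z₀ : ℂ) (hbar : ∀ z ∈ Metric.sphere z₀ r,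
      φ (γ z) + (κ * ‖z‖ ^ 2 + (c * z).re) < φ (γ z₀) + (κ * ‖z₀‖ ^ 2 + (c * z₀).re)) : False := by
  set Q : ℂ → ℝ := fun z => κ * ‖z‖ ^ 2 + (c * z).re with hQ
  have hQc : Continuous Q := by fun_prop
  let Φ : ℂ × H → ℝ := fun p => φ (γ p.1 + p.2) + Q p.1
  have hγc := hγ.continuous
  have hΦ : Continuous Φ := by fun_prop
  set m := φ (γ z₀) + Q z₀ with hm
  obtain ⟨u, v, -, hv, hsu, h0v, huv⟩ := generalized_tube_lemma (isCompact_sphere z₀ r)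
    (isCompact_singleton (x := (0 : H))) (isOpen_lt hΦ (continuous_const (y := m))) (by
      rintro ⟨z, y⟩ ⟨hz, rfl : y = 0⟩
      simpa only [Φ, hQ, add_zero, mem_ofPred_eq] using hbar z hz)
  obtain ⟨ρ', hρ', hball⟩ := Metric.isOpen_iff.mp hv 0 (h0v rfl)
  set ρ := min ρ' 1
  have hρ : 0 < ρ := lt_min hρ' one_pos
  have hcomp : IsCompact (Metric.closedBall z₀ r ×ˢ Metric.closedBall (0 : H) 1) :=
    (isCompact_closedBall _ _).prod (isCompact_closedBall _ _)
  obtain ⟨B, hB⟩ := hcomp.bddAbove_image hΦ.continuousOn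
  have hB' : ∀ p ∈ Metric.closedBall z₀ r ×ˢ Metric.closedBall (0 : H) 1, Φ p ≤ B :=
    fun p hp => hB (mem_image_of_mem _ hp)
  -- A penalty this large forces the maximiser to have `‖d‖ < ρ`, where the barrier on the circle
  -- still holds; hence `z₁` is interior.
  set K := (|B - m| + 1) / ρ ^ 2 with hK
  have hK0 : 0 < K := by positivity
  have hKρ : B - K * ρ ^ 2 < m := by
    rw [hK, div_mul_cancel₀ _ (by positivity)]
    linarith [le_abs_self (B - m)]
  obtain ⟨⟨z₁, d⟩, ⟨hz₁, hd⟩, hmax⟩ := hcomp.exists_isMaxOn ⟨(z₀, 0), by simp [hr.le]⟩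
    (f := fun p => Φ p - K * ‖p.2‖ ^ 2) (by fun_prop)
  have hmax' : ∀ z ∈ Metric.closedBall z₀ r, ∀ y ∈ Metric.closedBall (0 : H) 1,
      Φ (z, y) - K * ‖y‖ ^ 2 ≤ Φ (z₁, d) - K * ‖d‖ ^ 2 := fun z hz y hy => hmax ⟨hz, hy⟩
  have hge : m ≤ Φ (z₁, d) - K * ‖d‖ ^ 2 := by
    have := hmax' z₀ (by simp [hr.le]) 0 (by simp)
    simpa [Φ] using this
  have hdρ : ‖d‖ < ρ := by
    by_contra! hle
    have h1 := hB' (z₁, d) ⟨hz₁, hd⟩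
    have h2 : K * ρ ^ 2 ≤ K * ‖d‖ ^ 2 := by gcongr
    linarith
  have hz₁b : z₁ ∈ Metric.ball z₀ r := by
    rcases (Metric.mem_closedBall.mp hz₁).lt_or_eq with h1 | h1
    · exact h1
    · have h2 : Φ (z₁, d) < m :=
        huv ⟨hsu h1, hball (by simpa using hdρ.trans_le (min_le_left _ _))⟩
      linarith [show 0 ≤ K * ‖d‖ ^ 2 by positivity]
  set a := deriv γ z₁ with ha
  -- Moving `y` by `e t` while `z` moves by `t` keeps the argument of `φ` on a complex line. As `a`
  -- is the derivative, `e t = o(t)`, so `K * ‖e t‖ ^ 2` is beaten by `κ * ‖t‖ ^ 2`.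
  let e : ℂ → H := fun t => γ z₁ + t • a - γ (z₁ + t)
  have hed : Differentiable ℂ e := by fun_prop
  have he0 : e 0 = 0 := by simp [e]
  have he' : HasDerivAt e 0 0 := by
    have h1 : HasDerivAt (fun t => γ (z₁ + t)) a 0 := by
      have := (hγ z₁).hasDerivAt
      rw [← add_zero z₁] at this
      simpa using this.comp_const_add z₁ 0
    have h2 : HasDerivAt (fun t : ℂ => γ z₁ + t • a) a 0 := by
      simpa using ((hasDerivAt_id (0 : ℂ)).smul_const a).const_add (γ z₁)
    have h3 := h2.sub h1
    rwa [sub_self] at h3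
  set δ := Real.sqrt (κ / (2 * K)) with hδ
  have hδ0 : 0 < δ := Real.sqrt_pos.mpr (by positivity)
  have hδK : K * δ ^ 2 = κ / 2 := by
    rw [hδ, Real.sq_sqrt (by positivity)]
    field_simp
  have hev : ∀ᶠ t in 𝓝 (0 : ℂ), ‖e t‖ ≤ δ * ‖t‖ ∧ ‖d + e t‖ < 1 ∧ z₁ + t ∈ Metric.ball z₀ r := by
    refine Eventually.and ?_ (Eventually.and ?_ ?_)
    · have := he'.isLittleO.def hδ0
      simpa [he0] using this
    · have hc : Continuous fun t => ‖d + e t‖ := (hed.continuous.const_add d).norm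
      refine hc.continuousAt.eventually (gt_mem_nhds ?_)
      simpa [he0] using hdρ.trans_le (min_le_right _ _)
    · have hc : Continuous fun t : ℂ => z₁ + t := by fun_prop
      exact hc.continuousAt.eventually (Metric.isOpen_ball.mem_nhds (by simpa using hz₁b))
  obtain ⟨s', hs', hball'⟩ := Metric.eventually_nhds_iff_ball.mp hev
  set s := s' / 2 with hs
  have hs0 : 0 < s := by positivity
  -- The first order terms form the real part of a holomorphic function vanishing at 0, so they
  -- average out on the circle.
  let ψ : ℂ → ℂ := fun t => 2 * K * inner ℂ d (e t) - 2 * κ * (starRingEnd ℂ z₁) * t - c * t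
  have hψ : Differentiable ℂ ψ := by
    have : Differentiable ℂ fun t => inner ℂ d (e t) :=
      (innerSL ℂ d).differentiable.comp hed
    fun_prop
  have hψ0 : ψ 0 = 0 := by simp [ψ, he0]
  have hpt : ∀ t ∈ Metric.sphere (0 : ℂ) |s|,
      φ (γ z₁ + d + t • a) ≤ (φ (γ z₁ + d) - κ * s ^ 2 / 2) + (ψ t).re := by
    intro t ht
    have hts : ‖t‖ = s := by simpa [abs_of_pos hs0] using ht
    obtain ⟨h1, h2, h3⟩ := hball' t (by rw [mem_ball_zero_iff, hts, hs]; linarith)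
    have h4 := hmax' (z₁ + t) (Metric.ball_subset_closedBall h3) (d + e t)
      (by simpa using h2.le)
    have h5 : γ (z₁ + t) + (d + e t) = γ z₁ + d + t • a := by simp only [e]; abel
    have h6 : ‖d + e t‖ ^ 2 = ‖d‖ ^ 2 + 2 * (inner ℂ d (e t)).re + ‖e t‖ ^ 2 :=
      norm_add_sq (𝕜 := ℂ) d (e t)
    have h7 : ‖z₁ + t‖ ^ 2 = ‖z₁‖ ^ 2 + 2 * (starRingEnd ℂ z₁ * t).re + ‖t‖ ^ 2 := by
      have := norm_add_sq (𝕜 := ℂ) z₁ t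
      simpa [mul_comm] using this
    have h8 : K * ‖e t‖ ^ 2 ≤ κ * s ^ 2 / 2 := by
      calc K * ‖e t‖ ^ 2 ≤ K * (δ * ‖t‖) ^ 2 := by gcongr
        _ = (K * δ ^ 2) * s ^ 2 := by rw [hts]; ring
        _ = κ * s ^ 2 / 2 := by rw [hδK]; ring
    have h9 : (ψ t).re = 2 * K * (inner ℂ d (e t)).re - 2 * κ * (starRingEnd ℂ z₁ * t).re
        - (c * t).re := by
      have e1 : ψ t = ((2 * K : ℝ) : ℂ) * inner ℂ d (e t) -
          ((2 * κ : ℝ) : ℂ) * (starRingEnd ℂ z₁ * t) - c * t := by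
        simp only [ψ]; push_cast; ring
      rw [e1, Complex.sub_re, Complex.sub_re, Complex.re_ofReal_mul, Complex.re_ofReal_mul]
    simp only [Φ, hQ, h5, h6, h7, mul_add, Complex.add_re, hts] at h4
    rw [h9]
    linarith
  have hψre : Continuous fun t => (ψ t).re := Complex.continuous_re.comp hψ.continuous
  have hav := (h.le_circleAverage (γ z₁ + d) a s).trans (Real.circleAverage_mono
    (Continuous.continuousOn (by fun_prop)).circleIntegrable'
    (Continuous.continuousOn (by have := hψ.continuous; fun_prop)).circleIntegrable' hpt)
  rw [Real.circleAverage_fun_add continuousOn_const.circleIntegrable'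
    hψre.continuousOn.circleIntegrable',
    Real.circleAverage_const, circleAverage_re hψ.differentiableOn (subset_univ _), hψ0,
    Complex.zero_re] at hav
  linarith [show 0 < κ * s ^ 2 / 2 by positivity]

variable {E : Type*} [NormedAddCommGroup E] [NormedSpace ℂ E]

/-- A Taylor polynomial of `G` is `L ∘ γ`, with `γ` a curve of monomials in a finite-dimensional
Hilbert space and `L` linear. The sub-mean inequality passes to `φ ∘ L`, so the Hilbert space case
applies. -/
theorem SubMean.not_isLocalMax {φ : E → ℝ} (h : SubMean φ) (hφ : Continuous φ) {G : ℂ → E}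
    {z₀ : ℂ} (hG : AnalyticAt ℂ G z₀) {κ : ℝ} (hκ : 0 < κ) :
    ¬ IsLocalMax (fun z => φ (G z) + κ * ‖z‖ ^ 2) z₀ := by
  intro hmax
  obtain ⟨p, R, hp⟩ := hG
  obtain ⟨r', hr'0, hr'R⟩ := ENNReal.lt_iff_exists_nnreal_btwn.mp hp.r_pos
  have hr'0 : 0 < (r' : ℝ) := by exact_mod_cast hr'0
  obtain ⟨s, hs, hball⟩ := Metric.eventually_nhds_iff_ball.mp hmax
  set r := min (r' : ℝ) s / 2 with hrd
  have hr : 0 < r := by positivity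
  have hrr' : r < r' := (half_lt_self (by positivity)).trans_le (min_le_left _ _)
  have hrs : r < s := (half_lt_self (by positivity)).trans_le (min_le_right _ _)
  have hGc : ContinuousOn G (Metric.closedBall z₀ r) := by
    refine hp.continuousOn.mono fun z hz => ?_
    refine Metric.eball_subset_eball hr'R.le ?_
    rw [Metric.eball_coe]
    exact Metric.closedBall_subset_ball hrr' hz
  have hC := (isCompact_closedBall z₀ r).image_of_continuousOn hGc
  -- Giving up half of `κ` turns the local maximum into a strict one with margin `κ * r ^ 2 / 2` on
  -- the circle; the two approximations cost only `2 * η`.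
  set η := κ * r ^ 2 / 8 with hη
  have hη0 : 0 < η := by positivity
  obtain ⟨δ, hδ, hδφ⟩ := Metric.mem_uniformity_dist.mp
    (hC.uniformContinuousAt_of_continuousAt φ (fun x _ => hφ.continuousAt)
      (Metric.dist_mem_uniformity hη0))
  obtain ⟨n, hn⟩ := (Metric.tendstoUniformlyOn_iff.mp (hp.tendstoUniformlyOn hr'R) δ hδ).exists
  let L : EuclideanSpace ℂ (Fin n) →ₗ[ℂ] E :=
    { toFun := fun y => ∑ i, y i • p.coeff i
      map_add' := fun x y => by simp [add_smul, Finset.sum_add_distrib]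
      map_smul' := fun c x => by simp [Finset.smul_sum, mul_smul] }
  let γ : ℂ → EuclideanSpace ℂ (Fin n) := fun z => WithLp.toLp 2 fun i => (z - z₀) ^ (i : ℕ)
  have hγ : Differentiable ℂ γ := by
    rw [differentiable_euclidean]
    intro i
    simp only [γ]
    fun_prop
  have hLγ : ∀ z, L (γ z) = p.partialSum n (z - z₀) := fun z => by
    simp only [L, γ, LinearMap.coe_mk, AddHom.coe_mk, FormalMultilinearSeries.partialSum,
      FormalMultilinearSeries.apply_eq_pow_smul_coeff]
    exact Fin.sum_univ_eq_sum_range (fun i => (z - z₀) ^ i • p.coeff i) n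
  have hnear : ∀ z ∈ Metric.closedBall z₀ r, |φ (G z) - φ (L (γ z))| < η := fun z hz => by
    rw [hLγ]
    refine hδφ ?_ (mem_image_of_mem G hz)
    have := hn (z - z₀) (by
      rw [mem_ball_zero_iff, ← dist_eq_norm]
      exact (Metric.mem_closedBall.mp hz).trans_lt hrr')
    rwa [add_sub_cancel] at this
  refine (h.comp L).false_of_barrier_inner (hφ.comp L.continuous_of_finiteDimensional) hγ
    (half_pos hκ) hr (κ * starRingEnd ℂ z₀) z₀ fun z hz => ?_
  have hzr : ‖z - z₀‖ = r := by rwa [mem_sphere_iff_norm] at hz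
  have h1 : φ (G z) + κ * ‖z‖ ^ 2 ≤ φ (G z₀) + κ * ‖z₀‖ ^ 2 :=
    hball z (by rw [mem_ball_iff_norm, hzr]; exact hrs)
  have h2 := (abs_lt.mp (hnear z (Metric.sphere_subset_closedBall hz))).1
  have h3 := (abs_lt.mp (hnear z₀ (Metric.mem_closedBall_self hr.le))).2
  have h4 : r ^ 2 = ‖z‖ ^ 2 - 2 * (starRingEnd ℂ z₀ * z).re + ‖z₀‖ ^ 2 := by
    have := norm_sub_sq (𝕜 := ℂ) z₀ z
    rw [norm_sub_rev, hzr] at this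
    simp only [RCLike.inner_apply, RCLike.re_to_complex] at this
    rw [mul_comm z] at this
    linarith
  have h5 : (starRingEnd ℂ z₀ * z₀).re = ‖z₀‖ ^ 2 := by
    rw [mul_comm, Complex.mul_conj, Complex.normSq_eq_norm_sq, Complex.ofReal_re]
  simp only [Function.comp_apply, mul_assoc, Complex.re_ofReal_mul, h5]
  have h6 : κ * r ^ 2 = κ * ‖z‖ ^ 2 - 2 * κ * (starRingEnd ℂ z₀ * z).re + κ * ‖z₀‖ ^ 2 := by
    rw [h4]; ring
  linarith

/-- The maximum principle for the composition of a plurisubharmonic function with a holomorphic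
curve. -/
theorem SubMean.le_of_le_boundary [CompleteSpace E] {φ : E → ℝ} (h : SubMean φ)
    (hφ : Continuous φ) {G : ℂ → E} {K U V : Set ℂ} (hK : IsCompact K) (hU : IsOpen U)
    (hUK : U ⊆ K) (hV : IsOpen V) (hKV : K ⊆ V) (hG : DifferentiableOn ℂ G V) {M : ℝ}
    (hM : ∀ z ∈ K \ U, φ (G z) ≤ M) {z : ℂ} (hz : z ∈ K) : φ (G z) ≤ M := by
  by_contra! hlt
  obtain ⟨B, hB⟩ := hK.bddAbove_image (f := fun w : ℂ => ‖w‖ ^ 2) (by fun_prop)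
  have hB' : ∀ w ∈ K, ‖w‖ ^ 2 ≤ B := fun w hw => hB (mem_image_of_mem _ hw)
  have hB0 : 0 ≤ B := (sq_nonneg _).trans (hB' z hz)
  -- Small enough that the perturbation `κ * ‖w‖ ^ 2` cannot move the maximum over `K` out of `U`.
  set κ := (φ (G z) - M) / (B + 1) with hκd
  have hκ : 0 < κ := div_pos (by linarith) (by linarith)
  have hκB : κ * B < φ (G z) - M := by
    have h1 : κ * (B + 1) = φ (G z) - M := div_mul_cancel₀ _ (by linarith)
    linarith
  have hcont : ContinuousOn (fun w => φ (G w) + κ * ‖w‖ ^ 2) K :=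
    (hφ.comp_continuousOn (hG.continuousOn.mono hKV)).add (by fun_prop)
  obtain ⟨z₀, hz₀, hmax⟩ := hK.exists_isMaxOn ⟨z, hz⟩ hcont
  have hz₀U : z₀ ∈ U := by
    by_contra hnot
    have h1 := hM z₀ ⟨hz₀, hnot⟩
    have h2 : φ (G z) + κ * ‖z‖ ^ 2 ≤ φ (G z₀) + κ * ‖z₀‖ ^ 2 := hmax hz
    have h3 : κ * ‖z₀‖ ^ 2 ≤ κ * B := mul_le_mul_of_nonneg_left (hB' z₀ hz₀) hκ.le
    linarith [show 0 ≤ κ * ‖z‖ ^ 2 by positivity]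
  exact h.not_isLocalMax hφ (hG.analyticAt (hV.mem_nhds (hKV hz₀))) hκ
    (hmax.isLocalMax (mem_of_superset (hU.mem_nhds hz₀U) hUK))

/-- A form of the strong maximum principle for homogeneous plurisubharmonic functions. -/
theorem SubMean.lt_one_of_lt_one [CompleteSpace E] {φ : E → ℝ} (h : SubMean φ)
    (hφ : Continuous φ) (hom : ∀ (z : ℂ) (x : E), φ (z • x) = ‖z‖ * φ x) {G : ℂ → E} {R : ℝ}
    (hR : 1 < R) (hG : DifferentiableOn ℂ G (Metric.ball 0 R))
    (hle : ∀ z ∈ Metric.ball (0 : ℂ) R, φ (G z) ≤ 1) (h0 : φ (G 0) < 1) : φ (G 1) < 1 := by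
  obtain ⟨q, hq, hq1⟩ := exists_between (max_lt h0 one_pos)
  have hq0 : 0 < q := (le_max_right _ _).trans_lt hq
  obtain ⟨ρ, hqρ, hρ1⟩ := exists_between hq1
  have hρ0 : 0 < ρ := hq0.trans hqρ
  have hGc : ContinuousAt G 0 :=
    (hG.differentiableAt (Metric.isOpen_ball.mem_nhds (by simpa using one_pos.trans hR))).continuousAt
  obtain ⟨r, hr, hball⟩ := Metric.eventually_nhds_iff_ball.mp
    ((hφ.continuousAt.comp hGc).eventually (gt_mem_nhds ((le_max_left _ _).trans_lt hq)))
  obtain ⟨m, hm⟩ := exists_pow_lt_of_lt_one hr hρ1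
  obtain ⟨s, hsR, hs1⟩ : ∃ s : ℝ, s ^ m < R ∧ 1 < s := by
    have hc : Continuous fun s : ℝ => s ^ m := by fun_prop
    have : ∀ᶠ s : ℝ in 𝓝 1, s ^ m < R :=
      (isOpen_lt hc continuous_const).mem_nhds (by simpa using hR)
    exact ((this.filter_mono nhdsWithin_le_nhds).and (self_mem_nhdsWithin (s := Ioi 1))).exists
  have hs0 : 0 < s := one_pos.trans hs1
  have hnorm : Continuous fun w : ℂ => ‖w‖ := continuous_norm
  -- The maximum principle is applied to `w⁻¹ • G (w ^ m)` on `ρ ≤ ‖w‖ ≤ s`. By homogeneity the gain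
  -- is `1 / s < 1` outside, while inside `w ^ m` is so near 0 that the bound is `q / ρ < 1`; at `w
  -- = 1` the value is `G 1`.
  set V : Set ℂ := {w | w ≠ 0 ∧ ‖w ^ m‖ < R}
  have hV : IsOpen V :=
    isOpen_ne.inter (isOpen_lt ((continuous_pow m).norm) continuous_const)
  have hGd : DifferentiableOn ℂ (fun w => w⁻¹ • G (w ^ m)) V := by
    refine (differentiableOn_id.inv fun w hw => hw.1).smul
      (hG.comp (differentiableOn_id.pow m) fun w hw => ?_)
    simpa using hw.2
  have hK : IsCompact {w : ℂ | ρ ≤ ‖w‖ ∧ ‖w‖ ≤ s} := by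
    refine (isCompact_closedBall (0 : ℂ) s).of_isClosed_subset
      ((isClosed_le continuous_const hnorm).inter (isClosed_le hnorm continuous_const))
      fun w hw => by simpa using hw.2
  have hU : IsOpen {w : ℂ | ρ < ‖w‖ ∧ ‖w‖ < s} :=
    (isOpen_lt continuous_const hnorm).inter (isOpen_lt hnorm continuous_const)
  have hpow : ∀ w : ℂ, ‖w‖ ≤ s → ‖w ^ m‖ < R := fun w hw => by
    rw [norm_pow]
    exact (pow_le_pow_left₀ (norm_nonneg _) hw m).trans_lt hsR
  have hval : ∀ w : ℂ, φ (w⁻¹ • G (w ^ m)) = φ (G (w ^ m)) / ‖w‖ := fun w => by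
    rw [hom, norm_inv, inv_mul_eq_div]
  have key := h.le_of_le_boundary hφ hK hU (fun w hw => ⟨hw.1.le, hw.2.le⟩) hV
    (fun w hw => ⟨norm_pos_iff.mp (hρ0.trans_le hw.1), hpow w hw.2⟩) hGd
    (M := max (q / ρ) (1 / s)) (fun w hw => ?_) (z := 1) ⟨by simpa using hρ1.le, by simpa using hs1.le⟩
  · simp only [one_pow, inv_one, one_smul] at key
    exact key.trans_lt (max_lt ((div_lt_one hρ0).mpr hqρ) ((div_lt_one hs0).mpr hs1))
  · obtain ⟨⟨hw1, hw2⟩, hw3⟩ := hw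
    rw [hval]
    rcases hw1.eq_or_lt with h1 | h1
    · refine le_max_of_le_left ?_
      rw [← h1]
      gcongr
      refine (hball (w ^ m) ?_).le
      rwa [mem_ball_zero_iff, norm_pow, ← h1]
    · have h2 : ‖w‖ = s := hw2.antisymm (not_lt.mp fun h2 => hw3 ⟨h1, h2⟩)
      refine le_max_of_le_right ?_
      rw [h2]
      gcongr
      exact hle _ (by simpa using hpow w hw2)

end MaximumPrinciple

open scoped BoundedContinuousFunction

/-! ### Holomorphic maps into spaces of bounded sequences -/

section BoundedSequences

variable {F E : Type*} [NormedAddCommGroup F] [NormedSpace ℂ F]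
  [NormedAddCommGroup E] [NormedSpace ℂ E]

/-- A bound for the second order Taylor remainder of a bounded holomorphic function. -/
theorem norm_sub_sub_fderiv_le [CompleteSpace E] {f : F → E} {x : F} {R M : ℝ} (hR : 0 < R)
    (hf : DifferentiableOn ℂ f (Metric.ball x R)) (hM : ∀ y ∈ Metric.ball x R, ‖f y‖ ≤ M) {h : F}
    (hh : ‖h‖ < R) : ‖f (x + h) - f x - fderiv ℂ f x h‖ ≤ 4 * M / R ^ 2 * ‖h‖ ^ 2 := by
  rcases eq_or_ne h 0 with rfl | h0
  · simp
  have hn : 0 < ‖h‖ := norm_pos_iff.mpr h0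
  set r := R / ‖h‖ with hr
  have hr1 : 1 < r := (one_lt_div hn).mpr hh
  have hr0 : 0 < r := one_pos.trans hr1
  let g : ℂ → E := fun t => f (x + t • h)
  have hmem : ∀ t ∈ Metric.ball (0 : ℂ) r, x + t • h ∈ Metric.ball x R := fun t ht => by
    rw [mem_ball_zero_iff, hr, lt_div_iff₀ hn] at ht
    simpa [norm_smul] using ht
  have hg : DifferentiableOn ℂ g (Metric.ball 0 r) :=
    hf.comp (by fun_prop) hmem
  have hg0 : g 0 = f x := by simp [g]
  have hgm : MapsTo g (Metric.ball 0 r) (Metric.closedBall (g 0) (2 * M)) := fun t ht => by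
    rw [mem_closedBall_iff_norm, hg0, two_mul]
    exact (norm_sub_le _ _).trans (add_le_add (hM _ (hmem t ht)) (hM x (by simpa using hR)))
  have hs := fun t (ht : t ∈ Metric.ball (0 : ℂ) r) =>
    Complex.norm_dslope_le_div_of_mapsTo_ball hg hgm ht
  have hball : Metric.ball (0 : ℂ) r ∈ 𝓝 0 := Metric.ball_mem_nhds _ hr0
  -- Schwarz's lemma a second time, now for the difference quotient of `g`: its values at 1 and 0
  -- differ by the Taylor remainder.
  have h1 := Complex.dist_le_div_mul_dist_of_mapsTo_ball (R₂ := 2 * M / r + 2 * M / r)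
    ((Complex.differentiableOn_dslope hball).mpr hg) (fun t ht => by
      rw [mem_closedBall_iff_norm]
      exact (norm_sub_le _ _).trans (add_le_add (hs t ht) (hs 0 (by simpa using hr0))))
    (z := 1) (by simpa using hr1)
  have h2 : deriv g 0 = fderiv ℂ f x h := by
    have h3 : HasDerivAt (fun t : ℂ => x + t • h) h 0 := by
      simpa using ((hasDerivAt_id (0 : ℂ)).smul_const h).const_add x
    have h4 := (hf.differentiableAt (Metric.ball_mem_nhds x hR)).hasFDerivAt
    rw [show x = x + (0 : ℂ) • h by simp] at h4
    simpa [g, Function.comp_def] using (h4.comp_hasDerivAt (0 : ℂ) h3).deriv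
  rw [dslope_same, dslope_of_ne _ one_ne_zero, h2, slope_def_module, hg0, dist_eq_norm] at h1
  simp only [sub_zero, inv_one, one_smul, g, dist_zero_right, norm_one, mul_one] at h1
  refine h1.trans_eq ?_
  rw [hr]
  field_simp
  ring

/-- A locally bounded map into the bounded sequences is holomorphic when its components are. -/
theorem differentiableAt_of_coord [CompleteSpace E] {Φ : F → ℕ →ᵇ E} {x : F} {R M : ℝ}
    (hR : 0 < R) (hΦ : ∀ k, DifferentiableOn ℂ (fun y => Φ y k) (Metric.ball x R))
    (hM : ∀ y ∈ Metric.ball x R, ‖Φ y‖ ≤ M) : DifferentiableAt ℂ Φ x := by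
  have hM' : ∀ k, ∀ y ∈ Metric.ball x R, ‖Φ y k‖ ≤ M := fun k y hy =>
    ((Φ y).norm_coe_le_norm k).trans (hM y hy)
  have hder : ∀ k, ‖fderiv ℂ (fun y => Φ y k) x‖ ≤ 2 * M / R := fun k => by
    refine Complex.norm_fderiv_le_div_of_mapsTo_ball (hΦ k) (fun y hy => ?_) hR
    rw [mem_closedBall_iff_norm, two_mul]
    exact (norm_sub_le _ _).trans (add_le_add (hM' k y hy) (hM' k x (by simpa using hR)))
  have hbd : ∀ h k, ‖fderiv ℂ (fun y => Φ y k) x h‖ ≤ 2 * M / R * ‖h‖ := fun h k =>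
    ((fderiv ℂ (fun y => Φ y k) x).le_opNorm h).trans (by gcongr; exact hder k)
  let D : F →ₗ[ℂ] ℕ →ᵇ E :=
    { toFun := fun h => BoundedContinuousFunction.ofNormedAddCommGroupDiscrete
        (fun k => fderiv ℂ (fun y => Φ y k) x h) _ (hbd h)
      map_add' := fun h h' => by ext k; simp
      map_smul' := fun c h => by ext k; simp }
  have hM0 : 0 ≤ M := (norm_nonneg _).trans (hM x (by simpa using hR))
  have hD : ∀ h, ‖D h‖ ≤ 2 * M / R * ‖h‖ := fun h =>
    (BoundedContinuousFunction.norm_le (by positivity)).mpr (hbd h)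
  refine HasFDerivAt.differentiableAt (f' := D.mkContinuous _ hD) ?_
  rw [hasFDerivAt_iff_isLittleO_nhds_zero]
  -- The Taylor bound does not depend on `k`, hence holds in the sup norm.
  have hO : (fun h => Φ (x + h) - Φ x - D.mkContinuous _ hD h) =O[𝓝 0] fun h => ‖h‖ ^ 2 := by
    refine Asymptotics.IsBigO.of_bound (4 * M / R ^ 2) ?_
    filter_upwards [Metric.ball_mem_nhds (0 : F) hR] with h hh
    rw [norm_pow, norm_norm]
    refine (BoundedContinuousFunction.norm_le (by positivity)).mpr fun k => ?_
    exact norm_sub_sub_fderiv_le hR (hΦ k) (hM' k) (by simpa using hh)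
  refine hO.trans_isLittleO ?_
  rw [← Asymptotics.isLittleO_norm_right]
  simpa using Asymptotics.isLittleO_norm_pow_norm_pow (E' := F) one_lt_two

variable (E) in
/-- The space of convergent sequences. -/
def convergentSeq : Submodule ℂ (ℕ →ᵇ E) where
  carrier := {s | ∃ l, Tendsto s atTop (𝓝 l)}
  add_mem' := fun ⟨l, hl⟩ ⟨l', hl'⟩ => ⟨l + l', hl.add hl'⟩
  zero_mem' := ⟨0, tendsto_const_nhds⟩
  smul_mem' := fun c _ ⟨l, hl⟩ => ⟨c • l, hl.const_smul c⟩

theorem isClosed_convergentSeq [CompleteSpace E] :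
    IsClosed (convergentSeq E : Set (ℕ →ᵇ E)) := by
  refine isClosed_of_closure_subset fun s hs => ?_
  refine cauchySeq_tendsto_of_complete (Metric.cauchySeq_iff'.mpr fun ε hε => ?_)
  obtain ⟨t, ⟨l, hl⟩, hst⟩ := Metric.mem_closure_iff.mp hs (ε / 3) (by positivity)
  obtain ⟨N, hN⟩ := Metric.cauchySeq_iff'.mp hl.cauchySeq (ε / 3) (by positivity)
  have h1 : ∀ n, dist (s n) (t n) < ε / 3 := fun n =>
    (BoundedContinuousFunction.dist_coe_le_dist n).trans_lt hst
  refine ⟨N, fun n hn => ?_⟩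
  have h2 := dist_triangle4 (s n) (t n) (t N) (s N)
  have h3 := h1 N
  rw [dist_comm] at h3
  linarith [h1 n, hN n hn]

/-- The limit of a convergent sequence, as a continuous linear map. -/
noncomputable def limCLM : convergentSeq E →L[ℂ] E :=
  LinearMap.mkContinuous
    { toFun := fun s => s.2.choose
      map_add' := fun s t => tendsto_nhds_unique (s + t).2.choose_spec
        (s.2.choose_spec.add t.2.choose_spec)
      map_smul' := fun c s => tendsto_nhds_unique (c • s).2.choose_spec
        (s.2.choose_spec.const_smul c) } 1 fun s => by
    rw [one_mul]
    exact le_of_tendsto s.2.choose_spec.norm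
      (Eventually.of_forall fun k => s.1.norm_coe_le_norm k)

theorem tendsto_limCLM (s : convergentSeq E) : Tendsto s.1 atTop (𝓝 (limCLM s)) :=
  s.2.choose_spec

/-- Modulo convergent sequences Φ is zero near `x`, so its derivative takes values in convergent
sequences; composing it with the limit map gives the derivative of `g`. -/
theorem DifferentiableAt.of_tendsto [CompleteSpace E] {Φ : F → ℕ →ᵇ E} {x : F}
    (hΦ : DifferentiableAt ℂ Φ x) {g : F → E}
    (hg : ∀ᶠ y in 𝓝 x, Tendsto (Φ y) atTop (𝓝 (g y))) : DifferentiableAt ℂ g x := by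
  have hcl : IsClosed (convergentSeq E : Set (ℕ →ᵇ E)) := isClosed_convergentSeq
  obtain ⟨D, hD⟩ := hΦ
  have hDmem : ∀ h, D h ∈ convergentSeq E := by
    have h1 := (convergentSeq E).mkQL.hasFDerivAt.comp x hD
    have h2 : HasFDerivAt ((convergentSeq E).mkQL ∘ Φ)
        (0 : F →L[ℂ] (ℕ →ᵇ E) ⧸ convergentSeq E) x := by
      refine (hasFDerivAt_const (0 : (ℕ →ᵇ E) ⧸ convergentSeq E) x).congr_of_eventuallyEq ?_
      filter_upwards [hg] with y hy
      exact (Submodule.Quotient.mk_eq_zero _).mpr ⟨_, hy⟩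
    intro h
    have h3 := DFunLike.congr_fun (h1.unique h2) h
    exact (Submodule.Quotient.mk_eq_zero _).mp h3
  let D' : F →L[ℂ] E := limCLM.comp (D.codRestrict _ hDmem)
  have hD' : ∀ h, Tendsto (D h) atTop (𝓝 (D' h)) := fun h => tendsto_limCLM ⟨D h, hDmem h⟩
  refine HasFDerivAt.differentiableAt (f' := D') ?_
  rw [hasFDerivAt_iff_isLittleO] at hD ⊢
  refine Asymptotics.IsBigO.trans_isLittleO (Asymptotics.IsBigO.of_bound 1 ?_) hD
  filter_upwards [hg] with y hy
  rw [one_mul]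
  refine le_of_tendsto ((hy.sub hg.self_of_nhds).sub (hD' (y - x))).norm
    (Eventually.of_forall fun k => ?_)
  exact (Φ y - Φ x - D (y - x)).norm_coe_le_norm k

end BoundedSequences

/-! ### Vitali's theorem and the strong maximum principle on manifolds -/

section VitaliTheorem

variable {F A : Type v} [NormedAddCommGroup F] [NormedSpace ℂ F] [TopologicalSpace A]
  [ChartedSpace F A] [hA : BanachAnalyticManifold F A]
  {E : Type*} [NormedAddCommGroup E] [NormedSpace ℂ E] [CompleteSpace E]

/-- Vitali's theorem for bounded sequences of holomorphic maps into a Banach space. -/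
theorem exists_tendstoLocallyUniformly {f : ℕ → A → E} {M : ℝ}
    (hf : ∀ k, MDifferentiable 𝓘(ℂ, F) 𝓘(ℂ, E) (f k)) (hM : ∀ k a, ‖f k a‖ ≤ M) {S : Set A}
    (hS : ∀ a ∈ S, ∃ l, Tendsto (fun k => f k a) atTop (𝓝 l))
    (hne : (uniquenessPoints F S).Nonempty) :
    ∃ g : A → E, MDifferentiable 𝓘(ℂ, F) 𝓘(ℂ, E) g ∧ TendstoLocallyUniformly f g atTop := by
  have := hA.isManifold
  have := hA.connected
  let Φ : A → ℕ →ᵇ E := fun a =>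
    BoundedContinuousFunction.ofNormedAddCommGroupDiscrete (fun k => f k a) M fun k => hM k a
  have hdiff : ∀ a, DifferentiableAt ℂ (Φ ∘ (chartAt F a).symm) (chartAt F a a) := fun a => by
    obtain ⟨R, hR, hball⟩ := Metric.isOpen_iff.mp (chartAt F a).open_target _
      ((chartAt F a).map_source (mem_chart_source F a))
    refine differentiableAt_of_coord hR (M := max M 0) (fun k => ?_) fun y _ => ?_
    · exact (differentiableOn_comp_chart_symm (U := univ) (hf k).mdifferentiableOn a).mono
        fun y hy => ⟨hball hy, mem_univ _⟩
    · exact (BoundedContinuousFunction.norm_le (le_max_right _ _)).mpr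
        fun k => (hM k _).trans (le_max_left _ _)
  have hΦc : Continuous Φ := continuous_iff_continuousAt.mpr fun a => by
    have h1 := (hdiff a).continuousAt.comp
      ((chartAt F a).continuousAt (mem_chart_source F a))
    refine h1.congr ?_
    filter_upwards [(chartAt F a).open_source.mem_nhds (mem_chart_source F a)] with b hb
    simp [(chartAt F a).left_inv hb]
  have hcl : IsClosed (convergentSeq E : Set (ℕ →ᵇ E)) := isClosed_convergentSeq
  obtain ⟨z, -, hz⟩ := hne
  -- By Hahn–Banach on the quotient it suffices to test scalar holomorphic functions, which vanish
  -- on `S`; the uniqueness point is used with all of `A` as neighbourhood.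
  have hmem : ∀ a, Φ a ∈ convergentSeq E := fun a => by
    refine (Submodule.Quotient.mk_eq_zero _).mp
      (SeparatingDual.eq_zero_of_forall_dual_eq_zero (R := ℂ) fun Λ => ?_)
    let Λ' : (ℕ →ᵇ E) →L[ℂ] ℂ := Λ.comp (convergentSeq E).mkQL
    refine hz univ isOpen_univ isConnected_univ (mem_univ z) (Λ' ∘ Φ) (fun b _ => ?_)
      (fun b hb => ?_) a (mem_univ a)
    · refine MDifferentiableAt.mdifferentiableWithinAt
        (mdifferentiableAt_iff_comp_chart_symm.mpr ⟨(Λ'.continuous.comp hΦc).continuousAt, ?_⟩)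
      exact Λ'.differentiableAt.comp _ (hdiff b)
    · have h0 : (convergentSeq E).mkQL (Φ b) = 0 :=
        (Submodule.Quotient.mk_eq_zero _).mpr (hS b hb.2)
      simp only [Λ', Function.comp_apply, ContinuousLinearMap.comp_apply, h0, map_zero]
  choose g hg using hmem
  have hloc : TendstoLocallyUniformly f g atTop := by
    rw [Metric.tendstoLocallyUniformly_iff]
    intro ε hε a
    refine ⟨_, hΦc.continuousAt (Metric.ball_mem_nhds (Φ a) (show 0 < ε / 3 by positivity)), ?_⟩
    filter_upwards [Metric.tendsto_nhds.mp (hg a) (ε / 3) (by positivity)] with k hk b hb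
    have h1 : ∀ j, dist (f j b) (f j a) ≤ dist (Φ b) (Φ a) := fun j =>
      BoundedContinuousFunction.dist_coe_le_dist (f := Φ b) (g := Φ a) j
    have h2 : dist (Φ b) (Φ a) < ε / 3 := hb
    have h3 : dist (g b) (g a) ≤ dist (Φ b) (Φ a) :=
      le_of_tendsto ((hg b).dist (hg a)) (Eventually.of_forall h1)
    have h4 : dist (f k a) (g a) < ε / 3 := hk
    have h5 := dist_triangle4 (g b) (g a) (f k a) (f k b)
    rw [dist_comm (g a), dist_comm (f k a) (f k b)] at h5
    linarith [h1 k]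
  refine ⟨g, fun a => mdifferentiableAt_iff_comp_chart_symm.mpr ⟨?_, ?_⟩, hloc⟩
  · exact (hloc.continuous (Frequently.of_forall fun k => (hf k).continuous)).continuousAt
  · exact DifferentiableAt.of_tendsto (hdiff a) (Eventually.of_forall fun y => hg _)

/-- The strong maximum principle on manifolds for homogeneous plurisubharmonic functions. -/
theorem SubMean.comp_lt_one {φ : E → ℝ} (h : SubMean φ) (hφ : Continuous φ)
    (hom : ∀ (z : ℂ) (x : E), φ (z • x) = ‖z‖ * φ x) {g : A → E}
    (hg : MDifferentiable 𝓘(ℂ, F) 𝓘(ℂ, E) g) (hle : ∀ a, φ (g a) ≤ 1) {a₀ : A}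
    (h0 : φ (g a₀) < 1) (a : A) : φ (g a) < 1 := by
  have := hA.isManifold
  have := hA.connected
  have hopen : IsOpen {a | φ (g a) < 1} := isOpen_lt (hφ.comp hg.continuous) continuous_const
  have hclosed : IsClosed {a | φ (g a) < 1} := by
    refine isClosed_of_closure_subset fun a ha => ?_
    set e := chartAt F a
    have hae : a ∈ e.source := mem_chart_source F a
    obtain ⟨R, hR, hball⟩ := Metric.isOpen_iff.mp e.open_target _ (e.map_source hae)
    have hnear : e.source ∩ e ⁻¹' Metric.ball (e a) (R / 3) ∈ 𝓝 a :=
      inter_mem (e.open_source.mem_nhds hae)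
        (e.continuousAt hae (Metric.ball_mem_nhds _ (by positivity)))
    obtain ⟨b, ⟨hbe, hb⟩, hb1⟩ := mem_closure_iff_nhds.mp ha _ hnear
    have hb' : ‖e a - e b‖ < R / 3 := by
      rw [← dist_eq_norm, dist_comm]
      exact hb
    -- A disc with `b` at `t = 0` and `a` at `t = 1`. For `‖t‖ < 2` it stays within `3 * ‖e a - e b‖
    -- < R` of `e a`, inside the chart.
    let G : ℂ → E := fun t => (g ∘ e.symm) (e b + t • (e a - e b))
    have hG : DifferentiableOn ℂ G (Metric.ball 0 2) := by
      refine (differentiableOn_comp_chart_symm (U := univ) hg.mdifferentiableOn a).comp (by fun_prop)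
        fun t ht => ⟨hball ?_, mem_univ _⟩
      rw [mem_ball_zero_iff] at ht
      have h1 : e b + t • (e a - e b) - e a = (t - 1) • (e a - e b) := by
        rw [sub_smul, one_smul]
        abel
      have h2 : ‖t - 1‖ ≤ 3 := (norm_sub_le _ _).trans (by rw [norm_one]; linarith)
      rw [mem_ball_iff_norm, h1, norm_smul]
      calc ‖t - 1‖ * ‖e a - e b‖ ≤ 3 * ‖e a - e b‖ := by gcongr
        _ < R := by linarith
    have key := h.lt_one_of_lt_one hφ hom one_lt_two hG (fun t _ => hle _)
      (by simpa [G, e.left_inv hbe] using hb1)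
    simpa [G, e.left_inv hae] using key
  exact (IsClopen.eq_univ ⟨hclosed, hopen⟩ ⟨a₀, h0⟩).ge (mem_univ a)

end VitaliTheorem

/-! ### Plurisubharmonicity of the gauge and the strong Vitali property -/

section Equivalence

variable {E : Type u} [NormedAddCommGroup E] [NormedSpace ℂ E] {Ω : TopologicalSpace.Opens E}

theorem plurisubharmonicOn_gauge (hc : Continuous (gauge (Ω : Set E)))
    (h : SubMean (gauge (Ω : Set E))) :
    PlurisubharmonicOn (gauge (Ω : Set E)) (Ω : Set E) := by
  refine ⟨hc.upperSemicontinuous.upperSemicontinuousOn _, fun a b => ?_⟩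
  have hab : Continuous fun z : ℂ => gauge (Ω : Set E) (a + z • b) := hc.comp (by fun_prop)
  refine ⟨hab.upperSemicontinuous.upperSemicontinuousOn _, fun c r _ _ =>
    ⟨hab.continuousOn.circleIntegrable', ?_⟩⟩
  rw [Real.circleAverage_eq_circleAverage_zero_one]
  convert h (a + c • b) ((r : ℂ) • b) using 3 with z
  congr 1
  module

/-- Homogeneity removes the restriction to Ω: scaling by `s` brings any closed disc into Ω and
multiplies both sides of the inequality by `s`. -/
theorem IsBalancedDomain.subMean_gauge (hΩ : IsBalancedDomain Ω)
    (hc : Continuous (gauge (Ω : Set E)))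
    (h : PlurisubharmonicOn (gauge (Ω : Set E)) (Ω : Set E)) : SubMean (gauge (Ω : Set E)) := by
  intro a b
  have hab : Continuous fun z : ℂ => gauge (Ω : Set E) (a + z • b) := hc.comp (by fun_prop)
  obtain ⟨B, hB⟩ := (isCompact_closedBall (0 : ℂ) 1).bddAbove_image hab.continuousOn
  have hB' : ∀ z ∈ Metric.closedBall (0 : ℂ) 1, gauge (Ω : Set E) (a + z • b) ≤ B :=
    fun z hz => hB (mem_image_of_mem _ hz)
  have hB0 : 0 ≤ B := (gauge_nonneg _).trans (hB' 0 (by simp))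
  set s : ℝ := (B + 1)⁻¹ with hs
  have hs0 : 0 < s := by positivity
  have hsg : ∀ x : E, gauge (Ω : Set E) ((s : ℂ) • x) = s * gauge (Ω : Set E) x := fun x => by
    rw [hΩ.gauge_smul, Complex.norm_real, Real.norm_of_nonneg hs0.le]
  have heq : ∀ z : ℂ, (s : ℂ) • a + z • (s : ℂ) • b = (s : ℂ) • (a + z • b) := fun z => by
    module
  have key := ((h.2 ((s : ℂ) • a) ((s : ℂ) • b)).2 0 1 one_pos fun z hz => by
    rw [mem_ofPred_eq, heq, SetLike.mem_coe, hΩ.mem_iff, hsg, hs, inv_mul_lt_one₀ (by linarith)]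
    linarith [hB' z hz]).2
  simp only [heq, hsg, zero_smul, add_zero] at key
  have h2 := Real.circleAverage_fun_smul (a := s) (c := 0) (R := 1)
    (f := fun z : ℂ => gauge (Ω : Set E) (a + z • b))
  simp only [smul_eq_mul] at h2
  rw [h2] at key
  exact le_of_mul_le_mul_left key hs0

theorem IsBalancedDomain.hasSVP [CompleteSpace E] (hΩ : IsBalancedDomain Ω)
    (hb : Bornology.IsBounded (Ω : Set E)) (hc : Continuous (gauge (Ω : Set E)))
    (h : PlurisubharmonicOn (gauge (Ω : Set E)) (Ω : Set E)) : HasSVP.{u, v} E Ω := by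
  intro F _ _ A _ _ hA f hne
  obtain ⟨M, hM⟩ := isBounded_iff_forall_norm_le.mp hb
  have hf : ∀ k, MDifferentiable 𝓘(ℂ, F) 𝓘(ℂ, E) (fun a => ((f k).1 a : E)) := fun k a =>
    mdifferentiableAt_opens_iff.mp ((f k).2 a)
  obtain ⟨g, hg, hloc⟩ := exists_tendstoLocallyUniformly hf (fun k a => hM _ ((f k).1 a).2)
    (S := convergenceSet f)
    (fun a ⟨x, hx⟩ => ⟨x, (continuous_subtype_val.tendsto x).comp hx⟩) hne
  have hpt : ∀ a, Tendsto (fun k => ((f k).1 a : E)) atTop (𝓝 (g a)) := fun a =>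
    hloc.tendstoLocallyUniformlyOn.tendsto_at (mem_univ a)
  have hle : ∀ a, gauge (Ω : Set E) (g a) ≤ 1 := fun a =>
    le_of_tendsto ((hc.tendsto _).comp (hpt a))
      (Eventually.of_forall fun k => (hΩ.mem_iff.mp ((f k).1 a).2).le)
  obtain ⟨z, hz, -⟩ := hne
  -- The uniqueness point `z` is only in the closure of the convergence set, but this suffices for
  -- that set to contain some `a₀`, whose limit lies in Ω.
  obtain ⟨a₀, x, hx⟩ := closure_nonempty_iff.mp ⟨z, hz⟩
  have h0 : gauge (Ω : Set E) (g a₀) < 1 := by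
    rw [tendsto_nhds_unique (hpt a₀) ((continuous_subtype_val.tendsto x).comp hx)]
    exact hΩ.mem_iff.mp x.2
  have hgΩ : ∀ a, g a ∈ Ω := fun a => hΩ.mem_iff.mpr
    ((hΩ.subMean_gauge hc h).comp_lt_one hc hΩ.gauge_smul hg hle h0 a)
  refine ⟨⟨⟨fun a => ⟨g a, hgΩ a⟩, hg.continuous.subtype_mk _⟩, fun a =>
    mdifferentiableAt_opens_iff.mpr (hg a)⟩, tendsto_subtype_rng.mpr ?_⟩
  refine ContinuousMap.tendsto_of_tendstoLocallyUniformly ?_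
  rw [Metric.tendstoLocallyUniformly_iff] at hloc ⊢
  exact hloc

end Equivalence

end Vitali

theorem proposition4p6 {E : Type u} [NormedAddCommGroup E] [NormedSpace ℂ E]
    [CompleteSpace E] (Ω : TopologicalSpace.Opens E) (hΩ : Vitali.IsBalancedDomain Ω) :
    List.TFAE [
      Vitali.HasWVP.{u, v} E Ω,
      Bornology.IsBounded (Ω : Set E) ∧ Continuous (gauge (Ω : Set E)) ∧
        Vitali.PlurisubharmonicOn (gauge (Ω : Set E)) (Ω : Set E),
      Vitali.HasSVP.{u, v} E Ω] := by
  tfae_have 1 → 2 := fun h =>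
    ⟨h.isBounded hΩ, h.continuous_gauge hΩ, Vitali.plurisubharmonicOn_gauge
      (h.continuous_gauge hΩ) (h.gauge_le_circleAverage hΩ (h.continuous_gauge hΩ))⟩
  tfae_have 2 → 3 := fun h => hΩ.hasSVP h.1 h.2.1 h.2.2
  tfae_have 3 → 1 := fun h F _ _ A _ _ _ f hf => h F A f (hf.mono inter_subset_right)
  tfae_finish
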